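/- Let $M$ be a smooth manifold, let $\mathbb{K}$ be $\mathbb{C}$ or $\mathbb{R}$, let $C^\infty(M)$ be the algebra of smooth $\mathbb{K}$-valued functions on $M$, and let $\Gamma(TM)$ be the Lie algebra of its derivations (the smooth vector fields, complexified if $\mathbb{K}=\mathbb{C}$). A Lie algebroid $A$ over $M$ is a finitely generated projective $C^\infty(M)$-module with a $\mathbb{K}$-Lie bracket and a $C^\infty(M)$-linear Lie morphism $\rho\colon A\to\Gamma(TM)$ (the anchor) such that $[a,fb]=f[a,b]+(\rho(a)\cdot f)\,b$ for all $a,b\in A$ and $f\in C^\infty(M)$. It is transitive if $\rho$ is surjective. Let $A$ be a transitive Lie algebroid with kernel $L=\ker\rho$; write $\mathcal{L}$ for the vector bundle with $L=\Gamma(\mathcal{L})$, and $A_U$, $L_U$ for the sections over an open set $U$ of the vector bundles of $A$ and $L$. Let $\Omega^\bullet(A,L)=\bigoplus_q\Omega^q(A,L)$, where $\Omega^q(A,L)$ is the space of alternating $C^\infty(M)$-multilinear maps $A^q\to L$. Let $\mathfrak{g}$ be a finite dimensional Lie algebra over $\mathbb{K}$. Let $TLA(U,\mathfrak{g})=\Gamma(TU)\oplus\Gamma(U\times\mathfrak{g})$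 be the trivial Lie algebroid, and let $\Omega^\bullet_{TLA}(U,\mathfrak{g})=\bigoplus_q\Omega^q_{TLA}(U,\mathfrak{g})$, where $\Omega^q_{TLA}(U,\mathfrak{g})$ is the space of alternating $C^\infty(U)$-multilinear maps $TLA(U,\mathfrak{g})^q\to\Gamma(U\times\mathfrak{g})$. A local trivialization of $A$ is a triple $(U,\Psi,\nabla^0)$ consisting of an open set $U\subseteq M$, an isomorphism $\Psi\colon U\times\mathfrak{g}\to\mathcal{L}|_U$ of bundles in Lie algebras, and a $C^\infty(U)$-linear Lie morphism $\nabla^0\colon\Gamma(TU)\to A_U$ with $\rho\circ\nabla^0=\mathrm{id}$ and $[\nabla^0_X,\Psi(\gamma)]=\Psi(X\cdot\gamma)$ for all $X\in\Gamma(TU)$ and $\gamma\in\Gamma(U\times\mathfrak{g})$. It defines an isomorphism $S\colon TLA(U,\mathfrak{g})\to A_U$, $S(X\oplus\gamma)=\nabla^0_X+\Psi(\gamma)$. The trivialization over $U$ of a form $\omega\in\Omega^\bullet(A,L)$ is $\Psi^{-1}\circ\omega\circ S\in\Omega^\bullet_{TLA}(U,\mathfrak{g})$. Let $(U_i,\Psi_i,\nabla^{0,i})_{i\in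 I}$ be a Lie algebroid atlas of $A$, that is, a family of local trivializations with $\bigcup_iU_i=M$. For $U_{ij}=U_i\cap U_j\neq\emptyset$ put $\alpha^i_j=\Psi_i^{-1}\circ\Psi_j$, $s_i^j=S_j^{-1}\circ S_i$ (over $U_{ij}$) and $\widehat\alpha{}^{\,i}_j(\omega)=\alpha^i_j\circ\omega\circ s_i^j$ for $\omega\in\Omega^\bullet_{TLA}(U_{ij},\mathfrak{g})$. Let $(\omega^i_{\mathrm{loc}})_{i\in I}$ be a family of local forms, $\omega^i_{\mathrm{loc}}\in\Omega^\bullet_{TLA}(U_i,\mathfrak{g})$. Then there is a global form $\omega\in\Omega^\bullet(A,L)$ with $$\omega^i_{\mathrm{loc}}=\Psi_i^{-1}\circ\omega\circ S_i\quad\text{for all } i\in I$$ if and only if $$\widehat\alpha{}^{\,i}_j\bigl(\omega^j_{\mathrm{loc}}|_{U_{ij}}\bigr)=\omega^i_{\mathrm{loc}}|_{U_{ij}}\quad\text{for all } i,j\in I \text{ with } U_{ij}\neq\emptyset.$$ -/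

import Mathlib

open scoped Manifold ContDiff Topology
open TopologicalSpace (Opens)

noncomputable section

namespace TransitiveLieAlgebroid

section Functions

variable (𝕜 : Type*) [RCLike 𝕜] {E : Type*} [NormedAddCommGroup E] [NormedSpace ℝ E]
  {H : Type*} [TopologicalSpace H] (I : ModelWithCorners ℝ E H)
  (M : Type*) [TopologicalSpace M] [ChartedSpace H M]

/-- The smooth `𝕜`-valued functions on the real manifold `M`, as a subalgebra of all functions. -/
def smoothSubalgebra : Subalgebra 𝕜 (M → 𝕜) where
  carrier := {f | ContMDiff I 𝓘(ℝ, 𝕜) ∞ f}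
  mul_mem' {f g} hf hg :=
    ContDiff.comp_contMDiff (g := fun p : 𝕜 × 𝕜 => p.1 * p.2) (f := fun x => (f x, g x))
      contDiff_mul (ContMDiff.prodMk_space hf hg)
  add_mem' {f g} hf hg :=
    ContDiff.comp_contMDiff (g := fun p : 𝕜 × 𝕜 => p.1 + p.2) (f := fun x => (f x, g x))
      contDiff_add (ContMDiff.prodMk_space hf hg)
  algebraMap_mem' _ := contMDiff_const

/-- The algebra `C^∞(M)` of smooth `𝕜`-valued functions on `M`. -/
def SmoothFun : Type _ := smoothSubalgebra 𝕜 I M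

instance : CommRing (SmoothFun 𝕜 I M) := inferInstanceAs (CommRing (smoothSubalgebra 𝕜 I M))

instance : Algebra 𝕜 (SmoothFun 𝕜 I M) := inferInstanceAs (Algebra 𝕜 (smoothSubalgebra 𝕜 I M))

/-- The smooth vector fields on `M`, acting on smooth `𝕜`-valued functions: the derivations of
`C^∞(M)`. For `𝕜 = ℂ` these are the sections of the complexified tangent bundle. -/
abbrev VectorField : Type _ :=
  Derivation 𝕜 (SmoothFun 𝕜 I M) (SmoothFun 𝕜 I M)

variable {M}

/-- Evaluation of smooth functions at `x`. -/
def evalAt (x : M) : SmoothFun 𝕜 I M →ₐ[𝕜] 𝕜 :=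
  (Pi.evalAlgHom 𝕜 (fun _ : M => 𝕜) x).comp (smoothSubalgebra 𝕜 I M).val

/-- The ideal of the smooth functions that vanish at `x`. -/
def vanishingIdeal (x : M) : Ideal (SmoothFun 𝕜 I M) := RingHom.ker (evalAt 𝕜 I x)

variable (P : Type*) [AddCommGroup P] [Module (SmoothFun 𝕜 I M) P]

/-- The fibre at `x` of the vector bundle whose module of sections is `P`. -/
abbrev Fibre (x : M) : Type _ :=
  P ⧸ (vanishingIdeal 𝕜 I x • ⊤ : Submodule (SmoothFun 𝕜 I M) P)

variable {P}

/-- The value at `x` of a section `p`. -/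
def value (p : P) (x : M) : Fibre 𝕜 I P x := Submodule.Quotient.mk p

/-- `s` coincides with the global section `p` near the point `x`. -/
def AgreesNear {U : Opens M} (s : ∀ x : U, Fibre 𝕜 I P (x : M)) (p : P) (x : M) : Prop :=
  ∀ᶠ y in 𝓝 x, ∀ hy : y ∈ U, s ⟨y, hy⟩ = value 𝕜 I p y

/-- `s` is a smooth section over `U` of the vector bundle whose module of global sections is `P`:
near each point of `U` it coincides with a global section. -/
def IsSection {U : Opens M} (s : ∀ x : U, Fibre 𝕜 I P (x : M)) : Prop :=
  ∀ x ∈ U, ∃ p : P, AgreesNear 𝕜 I s p x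

/-- `γ` is a smooth section over `U` of the trivial bundle with fibre the finite dimensional
space `𝔤`: its coordinates are smooth. -/
def IsSmoothMap {𝔤 : Type*} [AddCommGroup 𝔤] [Module 𝕜 𝔤] {U : Opens M} (γ : U → 𝔤) : Prop :=
  ∀ φ : Module.Dual 𝕜 𝔤, ContMDiff I 𝓘(ℝ, 𝕜) ∞ fun x : U => φ (γ x)

/-- `δ = X · γ`, the derivative of the smooth map `γ : U → 𝔤` along the vector field `X` over `U`,
computed coordinatewise through germs. -/
def IsDerivativeAlong {𝔤 : Type*} [AddCommGroup 𝔤] [Module 𝕜 𝔤] {U : Opens M}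
    (X : ∀ x : U, Fibre 𝕜 I (VectorField 𝕜 I M) (x : M)) (γ δ : U → 𝔤) : Prop :=
  ∀ (φ : Module.Dual 𝕜 𝔤) (x : U) (D : VectorField 𝕜 I M) (f : SmoothFun 𝕜 I M),
    AgreesNear 𝕜 I X D x → (∀ᶠ y in 𝓝 (x : M), ∀ hy : y ∈ U, φ (γ ⟨y, hy⟩) = f.1 y) →
      φ (δ x) = (D f).1 x

end Functions

section Extension

variable {𝕜 : Type*} [RCLike 𝕜] {E : Type*} [NormedAddCommGroup E] [NormedSpace ℝ E]
  [FiniteDimensional ℝ E] {H : Type*} [TopologicalSpace H] {I : ModelWithCorners ℝ E H}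
  {M : Type*} [TopologicalSpace M] [ChartedSpace H M] [IsManifold I ∞ M] [T2Space M]

theorem exists_smoothFun_agrees {V : Opens M} {f : V → 𝕜} (hf : ContMDiff I 𝓘(ℝ, 𝕜) ∞ f)
    (x : V) : ∃ F : SmoothFun 𝕜 I M, ∀ᶠ y in 𝓝 (x : M), ∀ hy : y ∈ V, f ⟨y, hy⟩ = F.1 y := by
  classical
  let f' : M → 𝕜 := fun y => if h : y ∈ V then f ⟨y, h⟩ else 0
  have hf' : ∀ y ∈ V, ContMDiffAt I 𝓘(ℝ, 𝕜) ∞ f' y := by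
    intro y hy
    have := (contMDiffAt_subtype_iff (I := I) (I' := 𝓘(ℝ, 𝕜)) (n := ∞) (U := V) (f := f')
      (x := ⟨y, hy⟩)).1
    apply this
    have h2 : (fun z : V => f' z) = f := by
      funext z
      simp [f']
    rw [h2]
    exact hf _
  obtain ⟨χ, -, hχ⟩ := (SmoothBumpFunction.nhds_basis_tsupport (I := I) (x : M)).mem_iff.1
    (V.isOpen.mem_nhds x.2)
  refine ⟨⟨fun y => χ y • f' y, ?_⟩, ?_⟩
  · apply contMDiff_of_tsupport
    intro y hy
    have hy' : y ∈ tsupport χ := tsupport_smul_subset_left (χ : M → ℝ) f' hy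
    exact ContMDiffAt.smul χ.contMDiffAt (hf' y (hχ hy'))
  · filter_upwards [χ.eventuallyEq_one] with y hy hyV
    simp only [Pi.one_apply] at hy
    simp [f', hyV, hy]

theorem isSmoothMap_of_forall_exists {𝔤 : Type*} [AddCommGroup 𝔤] [Module 𝕜 𝔤] {V U : Opens M}
    {γ : V → 𝔤}
    (h : ∀ x (_ : x ∈ V), ∃ η : U → 𝔤, IsSmoothMap 𝕜 I η ∧ x ∈ U ∧
      ∀ᶠ y in 𝓝 x, ∀ (hy : y ∈ V) (hU : y ∈ U), γ ⟨y, hy⟩ = η ⟨y, hU⟩) :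
    IsSmoothMap 𝕜 I γ := by
  classical
  intro φ x
  obtain ⟨η, hη, hxU, hx⟩ := h x x.2
  obtain ⟨F, hF⟩ := exists_smoothFun_agrees (hη φ) ⟨x, hxU⟩
  have hF' : ContMDiffAt I 𝓘(ℝ, 𝕜) ∞ (fun y : V => F.1 (y : M)) x :=
    (contMDiffAt_subtype_iff (I := I) (I' := 𝓘(ℝ, 𝕜)) (n := ∞) (U := V) (f := F.1)
      (x := x)).2 (F.2 _)
  refine hF'.congr_of_eventuallyEq ?_
  have h1 := (continuous_subtype_val.continuousAt (x := x)).eventually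
    ((hx.and hF).and (U.isOpen.mem_nhds hxU))
  filter_upwards [h1] with y hy
  obtain ⟨⟨h1, h2⟩, h3⟩ := hy
  rw [← h2 h3, ← h1 y.2 h3]

theorem exists_isSmoothMap_agrees {𝔤 : Type*} [AddCommGroup 𝔤] [Module 𝕜 𝔤]
    [FiniteDimensional 𝕜 𝔤] {V : Opens M} (U : Opens M) {γ : V → 𝔤} (hγ : IsSmoothMap 𝕜 I γ)
    (x : V) : ∃ η : U → 𝔤, IsSmoothMap 𝕜 I η ∧
      ∀ᶠ y in 𝓝 (x : M), ∀ (hy : y ∈ V) (hU : y ∈ U), γ ⟨y, hy⟩ = η ⟨y, hU⟩ := by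
  let b := Module.finBasis 𝕜 𝔤
  choose F hF using fun k => exists_smoothFun_agrees (hγ (b.coord k)) x
  refine ⟨fun y => ∑ k, (F k).1 (y : M) • b k, ?_, ?_⟩
  · intro φ
    let G : SmoothFun 𝕜 I M := ∑ k, φ (b k) • F k
    have hG : ContMDiff I 𝓘(ℝ, 𝕜) ∞ (G.1 : M → 𝕜) := G.2
    have : (fun y : U => φ (∑ k, (F k).1 (y : M) • b k)) = fun y : U => G.1 (y : M) := by
      funext y
      change _ = evalAt 𝕜 I (y : M) (∑ k, φ (b k) • F k)
      rw [map_sum, map_sum]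
      refine Finset.sum_congr rfl fun k _ => ?_
      rw [map_smul, map_smul, smul_eq_mul, smul_eq_mul, mul_comm]
      rfl
    rw [this]
    exact hG.comp contMDiff_subtype_val
  · filter_upwards [Filter.eventually_all.2 hF] with y hy hyV hyU
    rw [← b.sum_repr (γ ⟨y, hyV⟩)]
    exact Finset.sum_congr rfl fun k _ => by rw [← hy k hyV]; rfl

end Extension

section Bracket

variable (𝕜 : Type*) [RCLike 𝕜] {E : Type*} [NormedAddCommGroup E] [NormedSpace ℝ E]
  {H : Type*} [TopologicalSpace H] (I : ModelWithCorners ℝ E H)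
  {M : Type*} [TopologicalSpace M] [ChartedSpace H M]
  {P : Type*} [LieRing P] [Module (SmoothFun 𝕜 I M) P]

/-- `u = [s, t]` for sections `s`, `t` over `U`. The bracket of a Lie algebroid is a local
operation, so that it restricts to sections over `U`: the value at `x` of `[s, t]` is that of
`[a, b]` for global sections `a`, `b` that coincide near `x` with `s`, `t`. -/
def IsBracket {U : Opens M} (s t u : ∀ x : U, Fibre 𝕜 I P (x : M)) : Prop :=
  ∀ (x : U) (a b : P), AgreesNear 𝕜 I s a x → AgreesNear 𝕜 I t b x →
    u x = value 𝕜 I ⁅a, b⁆ (x : M)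

end Bracket

section Algebroid

variable (𝕜 : Type*) [RCLike 𝕜] {E : Type*} [NormedAddCommGroup E] [NormedSpace ℝ E]
  {H : Type*} [TopologicalSpace H] (I : ModelWithCorners ℝ E H)
  (M : Type*) [TopologicalSpace M] [ChartedSpace H M]
  (A : Type*) [LieRing A] [LieAlgebra 𝕜 A] [Module (SmoothFun 𝕜 I M) A]
  [LieRingModule A (SmoothFun 𝕜 I M)] [LieRinehartRing (SmoothFun 𝕜 I M) A]
  [LieRinehartAlgebra 𝕜 (SmoothFun 𝕜 I M) A]

/-- The anchor `ρ : A → Γ(TM)`. A Lie algebroid over `M` is, through the module `A` of its sections, a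
finitely generated projective `C^∞(M)`-module that is a Lie–Rinehart algebra over `C^∞(M)`: it has a
Lie bracket and a `C^∞(M)`-linear Lie morphism `ρ` to the vector fields with
`[a, f b] = f [a, b] + (ρ(a) · f) b`. -/
def anchor : A →ₗ[SmoothFun 𝕜 I M] VectorField 𝕜 I M where
  toFun a := LieRinehartAlgebra.anchor 𝕜 (SmoothFun 𝕜 I M) A a
  map_add' a b := map_add (LieRinehartAlgebra.anchor 𝕜 (SmoothFun 𝕜 I M) A).toLieHom a b
  map_smul' f a := (LieRinehartAlgebra.anchor 𝕜 (SmoothFun 𝕜 I M) A).map_smul_apply f a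

/-- A Lie algebroid is transitive if its anchor is surjective. -/
def IsTransitive : Prop := Function.Surjective (anchor 𝕜 I M A)

/-- The kernel `L` of `A`. -/
abbrev Kernel : Submodule (SmoothFun 𝕜 I M) A := LinearMap.ker (anchor 𝕜 I M A)

variable {M}

/-- The anchor on the fibres at `x`. -/
def anchorAt (x : M) : Fibre 𝕜 I A x →ₗ[𝕜] Fibre 𝕜 I (VectorField 𝕜 I M) x :=
  (Submodule.mapQ _ _ (anchor 𝕜 I M A) (by
    rw [← Submodule.map_le_iff_le_comap, Submodule.map_smul'']
    exact smul_mono_right _ le_top)).restrictScalars 𝕜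

/-- The fibre at `x` of the vector bundle of the kernel `L` of a transitive Lie algebroid. -/
abbrev KernelFibre (x : M) : Submodule 𝕜 (Fibre 𝕜 I A x) := LinearMap.ker (anchorAt 𝕜 I A x)

variable {A}

/-- The value at `x` of a section of `L`. -/
def kernelValue (l : Kernel 𝕜 I M A) (x : M) : KernelFibre 𝕜 I A x :=
  ⟨value 𝕜 I l.1 x, by
    have h : anchorAt 𝕜 I A x (value 𝕜 I l.1 x) = Submodule.Quotient.mk (anchor 𝕜 I M A l.1) := rfl
    rw [LinearMap.mem_ker, h, LinearMap.mem_ker.1 l.2, Submodule.Quotient.mk_zero]⟩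

variable (A) (M)

/-- The forms `Ω^q(A, L)` of degree `q` on `A` with values in the kernel `L`. -/
abbrev Form (q : ℕ) : Type _ := A [⋀^Fin q]→ₗ[SmoothFun 𝕜 I M] Kernel 𝕜 I M A

end Algebroid

section FormAt

variable {𝕜 : Type*} [RCLike 𝕜] {E : Type*} [NormedAddCommGroup E] [NormedSpace ℝ E]
  {H : Type*} [TopologicalSpace H] {I : ModelWithCorners ℝ E H}
  {M : Type*} [TopologicalSpace M] [ChartedSpace H M]
  {A : Type*} [LieRing A] [LieAlgebra 𝕜 A] [Module (SmoothFun 𝕜 I M) A]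
  [LieRingModule A (SmoothFun 𝕜 I M)] [LieRinehartRing (SmoothFun 𝕜 I M) A]
  [LieRinehartAlgebra 𝕜 (SmoothFun 𝕜 I M) A]

theorem value_form_congr {q : ℕ} (w : Form 𝕜 I M A q) (x : M) (a b : Fin q → A)
    (h : ∀ k, value 𝕜 I (a k) x = value 𝕜 I (b k) x) :
    kernelValue 𝕜 I (w a) x = kernelValue 𝕜 I (w b) x := by
  classical
  have key : ∀ (c : Fin q → A) (k : Fin q) (u v : A), value 𝕜 I u x = value 𝕜 I v x →
      value 𝕜 I (w (Function.update c k u) : A) x = value 𝕜 I (w (Function.update c k v) : A) x := by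
    intro c k u v huv
    have hmem := (Submodule.Quotient.eq _).1 huv
    refine (Submodule.Quotient.eq _).2 ?_
    have hlin := Submodule.mem_map_of_mem (f := (Kernel 𝕜 I M A).subtype.comp
      (w.toMultilinearMap.toLinearMap c k)) hmem
    rw [Submodule.map_smul''] at hlin
    have h2 := smul_mono_right (vanishingIdeal 𝕜 I x)
      (le_top (a := Submodule.map ((Kernel 𝕜 I M A).subtype.comp
        (w.toMultilinearMap.toLinearMap c k)) ⊤)) hlin
    simpa using h2
  have all : ∀ s : Finset (Fin q),
      value 𝕜 I (w (s.piecewise a b) : A) x = value 𝕜 I (w b : A) x := by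
    intro s
    induction s using Finset.induction_on with
    | empty => simp
    | insert k s hk ih =>
      rw [← ih, Finset.piecewise_insert, key _ k (a k) (b k) (h k)]
      congr 3
      rw [Function.update_eq_self_iff]
      simp [hk]
  apply Subtype.ext
  have h2 := all Finset.univ
  rw [Finset.piecewise_univ] at h2
  exact h2

/-- Auxiliary function for `formAt`. -/
def formAtFun {q : ℕ} (w : Form 𝕜 I M A q) (x : M) (v : Fin q → Fibre 𝕜 I A x) :
    KernelFibre 𝕜 I A x :=
  kernelValue 𝕜 I (w fun k => (v k).out) x

theorem formAtFun_value {q : ℕ} (w : Form 𝕜 I M A q) (x : M) (a : Fin q → A) :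
    formAtFun w x (fun k => value 𝕜 I (a k) x) = kernelValue 𝕜 I (w a) x :=
  value_form_congr w x _ _ fun _ => Quotient.out_eq _

theorem exists_value_eq {q : ℕ} {x : M} (v : Fin q → Fibre 𝕜 I A x) :
    ∃ a : Fin q → A, v = fun k => value 𝕜 I (a k) x :=
  ⟨fun k => (v k).out, funext fun _ => (Quotient.out_eq _).symm⟩

theorem update_value {q : ℕ} [DecidableEq (Fin q)] {x : M} (a : Fin q → A) (k : Fin q) (c : A) :
    Function.update (fun l => value 𝕜 I (a l) x) k (value 𝕜 I c x)
      = fun l => value 𝕜 I (Function.update a k c l) x :=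
  (Function.comp_update (fun c => value 𝕜 I c x) a k c).symm

/-- The value at `x` of a form on `A` with values in `L`: the alternating map on the fibre that is
given by `(a₁(x), …, a_q(x)) ↦ w(a₁, …, a_q)(x)`. -/
def formAt {q : ℕ} (w : Form 𝕜 I M A q) (x : M) :
    Fibre 𝕜 I A x [⋀^Fin q]→ₗ[𝕜] KernelFibre 𝕜 I A x where
  toFun := formAtFun w x
  map_update_add' v k a b := by
    obtain ⟨v, rfl⟩ := exists_value_eq v
    induction a using Submodule.Quotient.induction_on with | _ a
    induction b using Submodule.Quotient.induction_on with | _ b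
    have h := congrArg (fun l => kernelValue 𝕜 I l x) (w.map_update_add v k a b)
    change formAtFun w x (Function.update _ k (value 𝕜 I (a + b) x))
      = formAtFun w x (Function.update _ k (value 𝕜 I a x))
        + formAtFun w x (Function.update _ k (value 𝕜 I b x))
    rw [update_value, update_value, update_value, formAtFun_value, formAtFun_value,
      formAtFun_value]
    exact h
  map_update_smul' v k c a := by
    obtain ⟨v, rfl⟩ := exists_value_eq v
    induction a using Submodule.Quotient.induction_on with | _ a
    have h := congrArg (fun l => kernelValue 𝕜 I l x)
      (w.map_update_smul v k (algebraMap 𝕜 (SmoothFun 𝕜 I M) c) a)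
    rw [algebraMap_smul, algebraMap_smul] at h
    change formAtFun w x (Function.update _ k (value 𝕜 I (c • a) x))
      = c • formAtFun w x (Function.update _ k (value 𝕜 I a x))
    rw [update_value, update_value, formAtFun_value, formAtFun_value]
    exact h
  map_eq_zero_of_eq' v i j h hij := by
    have := w.map_eq_zero_of_eq (fun k => (v k).out) (i := i) (j := j) (by simp [h]) hij
    rw [formAtFun, this]
    rfl

end FormAt

section Trivialization

variable (𝕜 : Type*) [RCLike 𝕜] {E : Type*} [NormedAddCommGroup E] [NormedSpace ℝ E]
  {H : Type*} [TopologicalSpace H] (I : ModelWithCorners ℝ E H)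
  (M : Type*) [TopologicalSpace M] [ChartedSpace H M]
  (A : Type*) [LieRing A] [LieAlgebra 𝕜 A] [Module (SmoothFun 𝕜 I M) A]
  [LieRingModule A (SmoothFun 𝕜 I M)] [LieRinehartRing (SmoothFun 𝕜 I M) A]
  [LieRinehartAlgebra 𝕜 (SmoothFun 𝕜 I M) A]
  (𝔤 : Type*) [LieRing 𝔤] [LieAlgebra 𝕜 𝔤]

/-- A local trivialization `(U, Ψ, ∇⁰)` of a transitive Lie algebroid `A`. The `C^∞(U)`-linear maps
`Ψ` and `∇⁰` between spaces of sections are given on the fibres. -/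
structure LocalTrivialization where
  /-- The domain. -/
  U : Opens M
  /-- The trivialization `Ψ : U × 𝔤 → L_U` of the bundle in Lie algebras `L`. -/
  Ψ : ∀ x : U, 𝔤 ≃ₗ[𝕜] KernelFibre 𝕜 I A (x : M)
  isSection_Ψ : ∀ γ : U → 𝔤, IsSmoothMap 𝕜 I γ →
    IsSection 𝕜 I fun x : U => (Ψ x (γ x) : Fibre 𝕜 I A (x : M))
  isSmoothMap_Ψ_symm : ∀ l : ∀ x : U, KernelFibre 𝕜 I A (x : M),
    (IsSection 𝕜 I fun x : U => (l x : Fibre 𝕜 I A (x : M))) →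
      IsSmoothMap 𝕜 I fun x : U => (Ψ x).symm (l x)
  /-- `[Ψ(γ), Ψ(η)] = Ψ([γ, η])`. -/
  Ψ_lie : ∀ γ η : U → 𝔤, IsSmoothMap 𝕜 I γ → IsSmoothMap 𝕜 I η →
    IsBracket 𝕜 I (fun x : U => (Ψ x (γ x) : Fibre 𝕜 I A (x : M)))
      (fun x : U => (Ψ x (η x) : Fibre 𝕜 I A (x : M)))
      (fun x : U => (Ψ x ⁅γ x, η x⁆ : Fibre 𝕜 I A (x : M)))
  /-- The flat local connection `∇⁰ : Γ(TU) → A_U`. -/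
  nabla : ∀ x : U, Fibre 𝕜 I (VectorField 𝕜 I M) (x : M) →ₗ[𝕜] Fibre 𝕜 I A (x : M)
  isSection_nabla : ∀ X : ∀ x : U, Fibre 𝕜 I (VectorField 𝕜 I M) (x : M), IsSection 𝕜 I X →
    IsSection 𝕜 I fun x : U => nabla x (X x)
  /-- `ρ ∘ ∇⁰ = id`. -/
  anchor_nabla : ∀ (x : U) (v : Fibre 𝕜 I (VectorField 𝕜 I M) (x : M)),
    anchorAt 𝕜 I A (x : M) (nabla x v) = v
  /-- `[∇⁰_X, ∇⁰_Y] = ∇⁰_[X, Y]`. -/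
  nabla_lie : ∀ X Y Z : ∀ x : U, Fibre 𝕜 I (VectorField 𝕜 I M) (x : M),
    IsSection 𝕜 I X → IsSection 𝕜 I Y → IsBracket 𝕜 I X Y Z →
      IsBracket 𝕜 I (fun x : U => nabla x (X x)) (fun x : U => nabla x (Y x))
        (fun x : U => nabla x (Z x))
  /-- `[∇⁰_X, Ψ(γ)] = Ψ(X · γ)`. -/
  nabla_lie_Ψ : ∀ (X : ∀ x : U, Fibre 𝕜 I (VectorField 𝕜 I M) (x : M)) (γ δ : U → 𝔤),
    IsSection 𝕜 I X → IsSmoothMap 𝕜 I γ → IsDerivativeAlong 𝕜 I X γ δ →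
      IsBracket 𝕜 I (fun x : U => nabla x (X x))
        (fun x : U => (Ψ x (γ x) : Fibre 𝕜 I A (x : M)))
        (fun x : U => (Ψ x (δ x) : Fibre 𝕜 I A (x : M)))

/-- A Lie algebroid atlas: a family of local trivializations whose domains cover `M`. -/
structure Atlas (ι : Type*) where
  triv : ι → LocalTrivialization 𝕜 I M A 𝔤
  cover : ∀ x : M, ∃ i, x ∈ (triv i).U

variable {M}

/-- The fibre at `x` of the bundle `TM ⊕ (M × 𝔤)` of the trivial Lie algebroid. -/
abbrev TLAFibre (x : M) : Type _ := Fibre 𝕜 I (VectorField 𝕜 I M) x × 𝔤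

variable {𝔤}

/-- `v = X ⊕ γ` is an element of `TLA(U, 𝔤)`. -/
def IsTLASection {U : Opens M} (v : ∀ x : U, TLAFibre 𝕜 I 𝔤 (x : M)) : Prop :=
  (IsSection 𝕜 I fun x : U => (v x).1) ∧ IsSmoothMap 𝕜 I fun x : U => (v x).2

variable (𝔤)

/-- The local forms `Ω^q_TLA(U, 𝔤)`, i.e. the `𝔤`-valued forms of degree `q` on the trivial Lie
algebroid `TLA(U, 𝔤)`: fields of alternating maps on the fibres that send smooth sections to smooth
maps. -/
def LocalForm (U : Opens M) (q : ℕ) :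
    Submodule 𝕜 (∀ x : U, TLAFibre 𝕜 I 𝔤 (x : M) [⋀^Fin q]→ₗ[𝕜] 𝔤) where
  carrier := {w | ∀ v : Fin q → ∀ x : U, TLAFibre 𝕜 I 𝔤 (x : M),
    (∀ k, IsTLASection 𝕜 I (v k)) → IsSmoothMap 𝕜 I fun x => w x fun k => v k x}
  add_mem' {w w'} hw hw' v hv φ := by
    have := ContDiff.comp_contMDiff (g := fun p : 𝕜 × 𝕜 => p.1 + p.2) contDiff_add
      (ContMDiff.prodMk_space (hw v hv φ) (hw' v hv φ))
    refine this.congr fun x => ?_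
    simp
  zero_mem' v _ φ := by
    refine (contMDiff_const (c := (0 : 𝕜))).congr fun x => ?_
    simp
  smul_mem' c w hw v hv φ := by
    have := hw v hv (c • φ)
    refine this.congr fun x => ?_
    simp

end Trivialization

section Localization

variable {𝕜 : Type*} [RCLike 𝕜] {E : Type*} [NormedAddCommGroup E] [NormedSpace ℝ E]
  {H : Type*} [TopologicalSpace H] {I : ModelWithCorners ℝ E H}
  {M : Type*} [TopologicalSpace M] [ChartedSpace H M]
  {A : Type*} [LieRing A] [LieAlgebra 𝕜 A] [Module (SmoothFun 𝕜 I M) A]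
  [LieRingModule A (SmoothFun 𝕜 I M)] [LieRinehartRing (SmoothFun 𝕜 I M) A]
  [LieRinehartAlgebra 𝕜 (SmoothFun 𝕜 I M) A]
  {𝔤 : Type*} [LieRing 𝔤] [LieAlgebra 𝕜 𝔤]

namespace LocalTrivialization

variable (T : LocalTrivialization 𝕜 I M A 𝔤)

/-- The isomorphism `S : TLA(U, 𝔤) → A_U`, `S(X ⊕ γ) = ∇⁰_X + Ψ(γ)`, on the fibres. -/
def S (x : T.U) : TLAFibre 𝕜 I 𝔤 (x : M) ≃ₗ[𝕜] Fibre 𝕜 I A (x : M) where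
  toFun v := T.nabla x v.1 + (T.Ψ x v.2 : Fibre 𝕜 I A (x : M))
  map_add' v v' := by
    simp only [Prod.fst_add, Prod.snd_add, map_add, Submodule.coe_add]
    abel
  map_smul' c v := by simp
  invFun a := (anchorAt 𝕜 I A (x : M) a,
    (T.Ψ x).symm ⟨a - T.nabla x (anchorAt 𝕜 I A (x : M) a), by
      rw [LinearMap.mem_ker, map_sub, T.anchor_nabla, sub_self]⟩)
  left_inv v := by
    have h : anchorAt 𝕜 I A (x : M) (T.Ψ x v.2 : Fibre 𝕜 I A (x : M)) = 0 :=
      LinearMap.mem_ker.1 (T.Ψ x v.2).2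
    refine Prod.ext ?_ ?_
    · simp [h, T.anchor_nabla]
    · simp [h, T.anchor_nabla]
  right_inv a := by simp

end LocalTrivialization

theorem isSection_congr {P : Type*} [AddCommGroup P] [Module (SmoothFun 𝕜 I M) P]
    {V U : Opens M} {s : ∀ x : V, Fibre 𝕜 I P (x : M)}
    (h : ∀ x (_ : x ∈ V), ∃ t : ∀ x : U, Fibre 𝕜 I P (x : M), IsSection 𝕜 I t ∧ x ∈ U ∧
      ∀ᶠ y in 𝓝 x, ∀ (hy : y ∈ V) (hU : y ∈ U), s ⟨y, hy⟩ = t ⟨y, hU⟩) :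
    IsSection 𝕜 I s := by
  intro x hx
  obtain ⟨t, ht, hxU, hst⟩ := h x hx
  obtain ⟨p, hp⟩ := ht x hxU
  refine ⟨p, ?_⟩
  filter_upwards [hp, hst, U.isOpen.mem_nhds hxU] with y h1 h2 h3 hy
  rw [h2 hy h3, h1 h3]

theorem isSection_value {P : Type*} [AddCommGroup P] [Module (SmoothFun 𝕜 I M) P] (U : Opens M)
    (p : P) : IsSection 𝕜 I fun x : U => value 𝕜 I p (x : M) :=
  fun _ _ => ⟨p, Filter.Eventually.of_forall fun _ _ => rfl⟩

theorem IsSection.add {P : Type*} [AddCommGroup P] [Module (SmoothFun 𝕜 I M) P] {U : Opens M}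
    {s t : ∀ x : U, Fibre 𝕜 I P (x : M)} (hs : IsSection 𝕜 I s) (ht : IsSection 𝕜 I t) :
    IsSection 𝕜 I fun x => s x + t x := by
  intro x hx
  obtain ⟨p, hp⟩ := hs x hx
  obtain ⟨r, hr⟩ := ht x hx
  refine ⟨p + r, ?_⟩
  filter_upwards [hp, hr] with y h1 h2 hy
  rw [h1 hy, h2 hy]
  rfl

theorem IsSection.sub {P : Type*} [AddCommGroup P] [Module (SmoothFun 𝕜 I M) P] {U : Opens M}
    {s t : ∀ x : U, Fibre 𝕜 I P (x : M)} (hs : IsSection 𝕜 I s) (ht : IsSection 𝕜 I t) :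
    IsSection 𝕜 I fun x => s x - t x := by
  intro x hx
  obtain ⟨p, hp⟩ := hs x hx
  obtain ⟨r, hr⟩ := ht x hx
  refine ⟨p - r, ?_⟩
  filter_upwards [hp, hr] with y h1 h2 hy
  rw [h1 hy, h2 hy]
  rfl

theorem IsSection.anchorAt {U : Opens M} {s : ∀ x : U, Fibre 𝕜 I A (x : M)}
    (hs : IsSection 𝕜 I s) : IsSection 𝕜 I fun x : U => anchorAt 𝕜 I A (x : M) (s x) := by
  intro x hx
  obtain ⟨p, hp⟩ := hs x hx
  refine ⟨anchor 𝕜 I M A p, ?_⟩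
  filter_upwards [hp] with y h1 hy
  rw [h1 hy]
  rfl

variable [FiniteDimensional ℝ E] [IsManifold I ∞ M] [T2Space M]

namespace LocalTrivialization

variable (T : LocalTrivialization 𝕜 I M A 𝔤)

theorem isSection_S [FiniteDimensional 𝕜 𝔤] {V : Opens M} (hV : V ≤ T.U)
    {v : ∀ x : V, TLAFibre 𝕜 I 𝔤 (x : M)} (hv : IsTLASection 𝕜 I v) :
    IsSection 𝕜 I fun x : V => T.S ⟨x, hV x.2⟩ (v x) := by
  refine isSection_congr (U := T.U) fun x hx => ?_
  obtain ⟨D, hD⟩ := hv.1 x hx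
  obtain ⟨η, hη, hγη⟩ := exists_isSmoothMap_agrees T.U hv.2 ⟨x, hx⟩
  refine ⟨_, (T.isSection_nabla _ (isSection_value T.U D)).add (T.isSection_Ψ η hη), hV hx, ?_⟩
  filter_upwards [hD, hγη] with y h1 h2 hy hU
  rw [← h1 hy, ← h2 hy hU]
  rfl

theorem isTLASection_S_symm {V : Opens M} (hV : V ≤ T.U)
    {s : ∀ x : V, Fibre 𝕜 I A (x : M)} (hs : IsSection 𝕜 I s) :
    IsTLASection 𝕜 I fun x : V => (T.S ⟨x, hV x.2⟩).symm (s x) := by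
  refine ⟨hs.anchorAt, isSmoothMap_of_forall_exists (U := T.U) fun x hx => ?_⟩
  obtain ⟨a, ha⟩ := hs x hx
  have hsec := isSection_value (𝕜 := 𝕜) (I := I) T.U a
  refine ⟨fun y => ((T.S y).symm (value 𝕜 I a (y : M))).2,
    T.isSmoothMap_Ψ_symm _ (hsec.sub (T.isSection_nabla _ hsec.anchorAt)), hV hx, ?_⟩
  filter_upwards [ha] with y h1 hy hU
  rw [h1 hy]

theorem isSmoothMap_Ψ_symm_of_le {V : Opens M} (hV : V ≤ T.U)
    {l : ∀ x : V, KernelFibre 𝕜 I A (x : M)}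
    (hl : IsSection 𝕜 I fun x : V => (l x : Fibre 𝕜 I A (x : M))) :
    IsSmoothMap 𝕜 I fun x : V => (T.Ψ ⟨x, hV x.2⟩).symm (l x) := by
  have h := (T.isTLASection_S_symm hV hl).2
  have heq : (fun x : V => ((T.S ⟨x, hV x.2⟩).symm (l x : Fibre 𝕜 I A (x : M))).2)
      = fun x : V => (T.Ψ ⟨x, hV x.2⟩).symm (l x) := by
    funext x
    have h0 : (T.S ⟨x, hV x.2⟩).symm (l x : Fibre 𝕜 I A (x : M))
        = (0, (T.Ψ ⟨x, hV x.2⟩).symm (l x)) := by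
      rw [LinearEquiv.symm_apply_eq]
      simp [S]
    rw [h0]
  rwa [heq] at h

theorem isSection_Ψ_of_le [FiniteDimensional 𝕜 𝔤] {V : Opens M} (hV : V ≤ T.U) {γ : V → 𝔤}
    (hγ : IsSmoothMap 𝕜 I γ) :
    IsSection 𝕜 I fun x : V => (T.Ψ ⟨x, hV x.2⟩ (γ x) : Fibre 𝕜 I A (x : M)) := by
  refine isSection_congr (U := T.U) fun x hx => ?_
  obtain ⟨η, hη, hγη⟩ := exists_isSmoothMap_agrees T.U hγ ⟨x, hx⟩
  refine ⟨_, T.isSection_Ψ η hη, hV hx, ?_⟩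
  filter_upwards [hγη] with y h2 hy hU
  rw [← h2 hy hU]

/-- The trivialization `w_loc = Ψ⁻¹ ∘ w ∘ S` over `U` of a form `w` in `Ω^q(A, L)`. -/
def loc [FiniteDimensional 𝕜 𝔤] {q : ℕ} (w : Form 𝕜 I M A q) : LocalForm 𝕜 I 𝔤 T.U q :=
  ⟨fun x => (T.Ψ x).symm.toLinearMap.compAlternatingMap
    ((formAt w (x : M)).compLinearMap (T.S x).toLinearMap), by
    intro v hv
    refine T.isSmoothMap_Ψ_symm (fun x => formAt w (x : M) fun k => T.S x (v k x)) ?_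
    intro x hx
    choose a ha using fun k => T.isSection_S le_rfl (hv k) x hx
    refine ⟨(w a : A), ?_⟩
    filter_upwards [Filter.eventually_all.2 ha] with y hy hyU
    have h : (fun k => T.S ⟨y, hyU⟩ (v k ⟨y, hyU⟩)) = fun k => value 𝕜 I (a k) y :=
      funext fun k => hy k hyU
    change ((formAtFun w y fun k => T.S ⟨y, hyU⟩ (v k ⟨y, hyU⟩) : KernelFibre 𝕜 I A y) :
      Fibre 𝕜 I A y) = _
    rw [h, formAtFun_value]
    rfl⟩

variable (T' : LocalTrivialization 𝕜 I M A 𝔤)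

/-- The change of trivialization `α^i_j = Ψ_i⁻¹ ∘ Ψ_j` at a point of `U_i ∩ U_j`, for `i = T` and
`j = T'`. -/
def alpha (x : (T.U ⊓ T'.U : Opens M)) : 𝔤 ≃ₗ[𝕜] 𝔤 :=
  (T'.Ψ ⟨x, x.2.2⟩).trans (T.Ψ ⟨x, x.2.1⟩).symm

/-- The isomorphism `s_i^j = S_j⁻¹ ∘ S_i` of `TLA(U_i ∩ U_j, 𝔤)` on the fibres, for `i = T` and
`j = T'`. -/
def transition (x : (T.U ⊓ T'.U : Opens M)) :
    TLAFibre 𝕜 I 𝔤 (x : M) ≃ₗ[𝕜] TLAFibre 𝕜 I 𝔤 (x : M) :=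
  (T.S ⟨x, x.2.1⟩).trans (T'.S ⟨x, x.2.2⟩).symm

/-- The map `α̂_j^i(w) = α^i_j ∘ w ∘ s_i^j` on `Ω^q_TLA(U_i ∩ U_j, 𝔤)`, for `i = T` and
`j = T'`. -/
def alphaHat [FiniteDimensional 𝕜 𝔤] {q : ℕ} (w : LocalForm 𝕜 I 𝔤 (T.U ⊓ T'.U) q) :
    LocalForm 𝕜 I 𝔤 (T.U ⊓ T'.U) q :=
  ⟨fun x => (alpha T T' x).toLinearMap.compAlternatingMap
    ((w.1 x).compLinearMap (transition T T' x).toLinearMap), by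
    intro v hv
    have h := w.2 (fun k x => transition T T' x (v k x)) fun k =>
      T'.isTLASection_S_symm inf_le_right (T.isSection_S inf_le_left (hv k))
    exact T.isSmoothMap_Ψ_symm_of_le inf_le_left (T'.isSection_Ψ_of_le inf_le_right h)⟩

end LocalTrivialization

/-- The restriction of a local form to a smaller open set. -/
def LocalForm.restrict [FiniteDimensional 𝕜 𝔤] {U V : Opens M} (hV : V ≤ U) {q : ℕ}
    (w : LocalForm 𝕜 I 𝔤 U q) : LocalForm 𝕜 I 𝔤 V q :=
  ⟨fun x => w.1 ⟨x, hV x.2⟩, by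
    intro v hv
    refine isSmoothMap_of_forall_exists (U := U) fun x hx => ?_
    choose D hD using fun k => (hv k).1 x hx
    choose η hη hvη using fun k => exists_isSmoothMap_agrees U (hv k).2 ⟨x, hx⟩
    refine ⟨_, w.2 (fun k y => (value 𝕜 I (D k) (y : M), η k y)) fun k =>
      ⟨isSection_value U (D k), hη k⟩, hV hx, ?_⟩
    filter_upwards [Filter.eventually_all.2 hD, Filter.eventually_all.2 hvη] with y h1 h2 hy hU
    congr 1
    funext k
    exact Prod.ext (h1 k hy) (h2 k hy hU)⟩

end Localization

end TransitiveLieAlgebroid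

end

open TransitiveLieAlgebroid

/-! A local trivialization over `U` identifies the fibres of `TLA(U, 𝔤)` and `U × 𝔤` with those of
`A` and `L`, so a local form is the same thing as a smooth field `Ψ ∘ w ∘ S⁻¹` of alternating maps
on the fibres of `A`, and the compatibility condition says exactly that these fields agree on the
overlaps. Compatible local forms therefore glue to a smooth field on `M`. Since `A` is a finitely
generated projective module, a section that is locally the restriction of an element of `A` comes
from a unique element of `A`: its coordinates with respect to a finite dual basis are smooth
because smoothness is local. Hence the glued field is the field of values of a global form. Only
finitely many degrees occur, because an alternating map vanishes in degrees above the number of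
generators of `A`. -/

namespace TransitiveLieAlgebroid

section Algebra

theorem alternatingMap_eq_zero_of_span_eq_top {R V N ι κ : Type*} [CommSemiring R]
    [AddCommMonoid V] [Module R V] [AddCommMonoid N] [Module R N] [Fintype ι] [Fintype κ]
    {e : κ → V} (he : Submodule.span R (Set.range e) = ⊤)
    (hcard : Fintype.card κ < Fintype.card ι) (w : V [⋀^ι]→ₗ[R] N) : w = 0 := by
  refine AlternatingMap.coe_multilinearMap_injective
    (MultilinearMap.ext_of_span_eq_top (fun _ => he) fun j => ?_)
  refine w.map_eq_zero_of_not_injective _ fun hinj => hcard.not_ge ?_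
  exact Fintype.card_le_of_injective j (Function.Injective.of_comp (f := e) hinj)

theorem exists_forall_alternatingMap_eq_zero (R V N : Type*) [CommSemiring R]
    [AddCommMonoid V] [Module R V] [AddCommMonoid N] [Module R N] [Module.Finite R V] :
    ∃ n, ∀ q, n < q → ∀ w : V [⋀^Fin q]→ₗ[R] N, w = 0 := by
  obtain ⟨s, hs⟩ := Module.finite_def.1 ‹Module.Finite R V›
  refine ⟨s.card, fun q hq => alternatingMap_eq_zero_of_span_eq_top (e := ((↑) : s → V)) ?_ ?_⟩
  · rwa [Subtype.range_coe]
  · rwa [Fintype.card_coe, Fintype.card_fin]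

theorem exists_directSum_apply_eq {ι : Type*} {β : ι → Type*}
    [∀ i, AddCommMonoid (β i)] (f : ∀ i, β i) (s : Finset ι) (hf : ∀ i ∉ s, f i = 0) :
    ∃ F : DirectSum ι β, ∀ i, F i = f i := by
  classical
  refine ⟨DirectSum.mk β s fun i => f i, fun i => ?_⟩
  by_cases hi : i ∈ s
  · exact DirectSum.mk_apply_of_mem hi
  · exact (DirectSum.mk_apply_of_notMem hi).trans (hf i hi).symm

end Algebra

section Values

variable {𝕜 : Type*} [RCLike 𝕜] {E : Type*} [NormedAddCommGroup E] [NormedSpace ℝ E]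
  {H : Type*} [TopologicalSpace H] {I : ModelWithCorners ℝ E H}
  {M : Type*} [TopologicalSpace M] [ChartedSpace H M]

theorem SmoothFun.ext_evalAt {f g : SmoothFun 𝕜 I M}
    (h : ∀ x, evalAt 𝕜 I x f = evalAt 𝕜 I x g) : f = g :=
  Subtype.ext (funext h)

variable {P : Type*} [AddCommGroup P] [Module (SmoothFun 𝕜 I M) P]

theorem value_surjective (x : M) : Function.Surjective fun p : P => value 𝕜 I p x :=
  Submodule.mkQ_surjective _

theorem value_add (p p' : P) (x : M) : value 𝕜 I (p + p') x = value 𝕜 I p x + value 𝕜 I p' x :=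
  rfl

theorem value_smul [Module 𝕜 P] [IsScalarTower 𝕜 (SmoothFun 𝕜 I M) P] (f : SmoothFun 𝕜 I M)
    (p : P) (x : M) : value 𝕜 I (f • p) x = evalAt 𝕜 I x f • value 𝕜 I p x := by
  have hmem : f • p - evalAt 𝕜 I x f • p ∈
      (vanishingIdeal 𝕜 I x • ⊤ : Submodule (SmoothFun 𝕜 I M) P) := by
    rw [← algebraMap_smul (SmoothFun 𝕜 I M) (evalAt 𝕜 I x f) p, ← sub_smul]
    refine Submodule.smul_mem_smul (RingHom.mem_ker.2 ?_) Submodule.mem_top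
    exact (map_sub (evalAt 𝕜 I x) _ _).trans (sub_eq_zero.2 ((evalAt 𝕜 I x).commutes _).symm)
  exact (Submodule.Quotient.eq _).2 hmem

theorem evalAt_map_congr (φ : P →ₗ[SmoothFun 𝕜 I M] SmoothFun 𝕜 I M) {x : M} {p p' : P}
    (h : value 𝕜 I p x = value 𝕜 I p' x) : evalAt 𝕜 I x (φ p) = evalAt 𝕜 I x (φ p') := by
  have hmem := Submodule.mem_map_of_mem (f := φ) ((Submodule.Quotient.eq _).1 h)
  rw [Submodule.map_smul'', map_sub] at hmem
  have hvanish : φ p - φ p' ∈ vanishingIdeal 𝕜 I x :=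
    Submodule.smul_le.2 (fun f hf g _ => Ideal.mul_mem_right g _ hf) hmem
  exact sub_eq_zero.1 ((map_sub (evalAt 𝕜 I x) _ _).symm.trans (RingHom.mem_ker.1 hvanish))

theorem value_map_congr {κ : Type*} [Finite κ]
    (f : (κ → SmoothFun 𝕜 I M) →ₗ[SmoothFun 𝕜 I M] P) {x : M} {u v : κ → SmoothFun 𝕜 I M}
    (h : ∀ k, evalAt 𝕜 I x (u k) = evalAt 𝕜 I x (v k)) :
    value 𝕜 I (f u) x = value 𝕜 I (f v) x := by
  classical
  have := Fintype.ofFinite κ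
  refine (Submodule.Quotient.eq _).2 ?_
  rw [← map_sub, LinearMap.pi_apply_eq_sum_univ]
  refine Submodule.sum_mem _ fun k _ => Submodule.smul_mem_smul (RingHom.mem_ker.2 ?_) trivial
  exact (map_sub (evalAt 𝕜 I x) _ _).trans (sub_eq_zero.2 (h k))

theorem map_eq_of_forall_value_eq (φ : P →ₗ[SmoothFun 𝕜 I M] SmoothFun 𝕜 I M) {p p' : P}
    (h : ∀ x : M, value 𝕜 I p x = value 𝕜 I p' x) : φ p = φ p' :=
  SmoothFun.ext_evalAt fun x => evalAt_map_congr φ (h x)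

theorem eq_of_forall_value_eq [Module.Projective (SmoothFun 𝕜 I M) P] {p p' : P}
    (h : ∀ x : M, value 𝕜 I p x = value 𝕜 I p' x) : p = p' := by
  refine sub_eq_zero.1 ((Module.forall_dual_apply_eq_zero_iff (SmoothFun 𝕜 I M) _).1 fun φ => ?_)
  rw [map_sub, map_eq_of_forall_value_eq φ h, sub_self]

theorem vectorField_eq_of_forall_value_eq {D D' : VectorField 𝕜 I M}
    (h : ∀ x : M, value 𝕜 I D x = value 𝕜 I D' x) : D = D' := by
  ext1 f
  let evalOn : VectorField 𝕜 I M →ₗ[SmoothFun 𝕜 I M] SmoothFun 𝕜 I M :=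
    { toFun := fun D => D f, map_add' := fun _ _ => rfl, map_smul' := fun _ _ => rfl }
  exact map_eq_of_forall_value_eq evalOn h

theorem IsSection.exists_smoothFun {s : ∀ x : M, Fibre 𝕜 I P x}
    (hs : IsSection 𝕜 I fun x : (⊤ : Opens M) => s x)
    (φ : P →ₗ[SmoothFun 𝕜 I M] SmoothFun 𝕜 I M) :
    ∃ F : SmoothFun 𝕜 I M,
      ∀ x p, value 𝕜 I p x = s x → evalAt 𝕜 I x F = evalAt 𝕜 I x (φ p) := by
  choose a ha using fun x => value_surjective x (s x)
  have hsmooth : ContMDiff I 𝓘(ℝ, 𝕜) ∞ fun x => evalAt 𝕜 I x (φ (a x)) := fun x => by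
    obtain ⟨p, hp⟩ := hs x trivial
    refine ((φ p).2 x).congr_of_eventuallyEq ?_
    filter_upwards [hp] with y hy
    exact evalAt_map_congr φ ((ha y).trans (hy trivial))
  exact ⟨⟨_, hsmooth⟩, fun x p hp => evalAt_map_congr φ ((ha x).trans hp.symm)⟩

theorem IsSection.exists_value_eq [Module.Finite (SmoothFun 𝕜 I M) P]
    [Module.Projective (SmoothFun 𝕜 I M) P] {s : ∀ x : M, Fibre 𝕜 I P x}
    (hs : IsSection 𝕜 I fun x : (⊤ : Opens M) => s x) : ∃ p : P, ∀ x, value 𝕜 I p x = s x := by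
  obtain ⟨n, f, g, -, -, hfg⟩ :=
    Module.Finite.exists_comp_eq_id_of_projective (SmoothFun 𝕜 I M) P
  choose F hF using fun k : Fin n => hs.exists_smoothFun (LinearMap.proj k ∘ₗ g)
  refine ⟨f F, fun x => ?_⟩
  obtain ⟨p, hp⟩ := value_surjective x (s x)
  calc value 𝕜 I (f F) x = value 𝕜 I (f (g p)) x := value_map_congr f fun k => hF k x p hp
    _ = value 𝕜 I p x := congrArg (value 𝕜 I · x) (LinearMap.congr_fun hfg p)
    _ = s x := hp

end Values

section Forms

variable {𝕜 : Type*} [RCLike 𝕜] {E : Type*} [NormedAddCommGroup E] [NormedSpace ℝ E]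
  {H : Type*} [TopologicalSpace H] {I : ModelWithCorners ℝ E H}
  {M : Type*} [TopologicalSpace M] [ChartedSpace H M]
  {A : Type*} [LieRing A] [LieAlgebra 𝕜 A] [Module (SmoothFun 𝕜 I M) A]
  [LieRingModule A (SmoothFun 𝕜 I M)] [LieRinehartRing (SmoothFun 𝕜 I M) A]
  [LieRinehartAlgebra 𝕜 (SmoothFun 𝕜 I M) A]

theorem mem_kernel_of_forall_anchorAt_eq_zero {a : A}
    (h : ∀ x : M, anchorAt 𝕜 I A x (value 𝕜 I a x) = 0) : a ∈ Kernel 𝕜 I M A :=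
  LinearMap.mem_ker.2 (vectorField_eq_of_forall_value_eq h)

theorem kernelValue_add (l l' : Kernel 𝕜 I M A) (x : M) :
    kernelValue 𝕜 I (l + l') x = kernelValue 𝕜 I l x + kernelValue 𝕜 I l' x :=
  Subtype.ext (value_add l.1 l'.1 x)

theorem kernelValue_smul (f : SmoothFun 𝕜 I M) (l : Kernel 𝕜 I M A) (x : M) :
    kernelValue 𝕜 I (f • l) x = evalAt 𝕜 I x f • kernelValue 𝕜 I l x :=
  Subtype.ext (value_smul f l.1 x)

variable [Module.Projective (SmoothFun 𝕜 I M) A]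

theorem kernel_eq_of_forall_kernelValue_eq {l l' : Kernel 𝕜 I M A}
    (h : ∀ x, kernelValue 𝕜 I l x = kernelValue 𝕜 I l' x) : l = l' :=
  Subtype.ext (eq_of_forall_value_eq fun x => congrArg Subtype.val (h x))

variable [Module.Finite (SmoothFun 𝕜 I M) A]

theorem exists_kernelValue_eq {s : ∀ x : M, KernelFibre 𝕜 I A x}
    (hs : IsSection 𝕜 I fun x : (⊤ : Opens M) => (s x : Fibre 𝕜 I A (x : M))) :
    ∃ l : Kernel 𝕜 I M A, ∀ x, kernelValue 𝕜 I l x = s x := by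
  obtain ⟨a, ha⟩ := IsSection.exists_value_eq (s := fun x => (s x : Fibre 𝕜 I A x)) hs
  have hker : a ∈ Kernel 𝕜 I M A := mem_kernel_of_forall_anchorAt_eq_zero fun x => by
    rw [ha]
    exact (s x).2
  exact ⟨⟨a, hker⟩, fun x => Subtype.ext (ha x)⟩

theorem exists_formAt_eq {q : ℕ}
    (η : ∀ x : M, Fibre 𝕜 I A x [⋀^Fin q]→ₗ[𝕜] KernelFibre 𝕜 I A x)
    (hη : ∀ a : Fin q → A, IsSection 𝕜 I fun x : (⊤ : Opens M) =>
      (η x fun k => value 𝕜 I (a k) (x : M) : Fibre 𝕜 I A (x : M))) :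
    ∃ W : Form 𝕜 I M A q, ∀ x, formAt W x = η x := by
  choose F hF using fun a : Fin q → A =>
    exists_kernelValue_eq (s := fun x => η x fun k => value 𝕜 I (a k) x) (hη a)
  let W : Form 𝕜 I M A q :=
    { toFun := F
      map_update_add' := fun a k b c => kernel_eq_of_forall_kernelValue_eq fun x => by
        rw [kernelValue_add, hF, hF, hF, ← update_value, ← update_value, ← update_value, value_add,
          (η x).map_update_add]
      map_update_smul' := fun a k f b => kernel_eq_of_forall_kernelValue_eq fun x => by
        rw [kernelValue_smul, hF, hF, ← update_value, ← update_value, value_smul,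
          (η x).map_update_smul]
      map_eq_zero_of_eq' := fun a i j h hij => kernel_eq_of_forall_kernelValue_eq fun x =>
        (hF a x).trans ((η x).map_eq_zero_of_eq _ (congrArg (value 𝕜 I · x) h) hij) }
  refine ⟨W, fun x => AlternatingMap.ext fun v => ?_⟩
  obtain ⟨a, rfl⟩ := exists_value_eq v
  exact (formAtFun_value W x a).trans (hF a x)

end Forms

section Gluing

variable {𝕜 : Type*} [RCLike 𝕜] {E : Type*} [NormedAddCommGroup E] [NormedSpace ℝ E]
  {H : Type*} [TopologicalSpace H] {I : ModelWithCorners ℝ E H}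
  {M : Type*} [TopologicalSpace M] [ChartedSpace H M]
  {A : Type*} [LieRing A] [LieAlgebra 𝕜 A] [Module (SmoothFun 𝕜 I M) A]
  [LieRingModule A (SmoothFun 𝕜 I M)] [LieRinehartRing (SmoothFun 𝕜 I M) A]
  [LieRinehartAlgebra 𝕜 (SmoothFun 𝕜 I M) A]
  {𝔤 : Type*} [LieRing 𝔤] [LieAlgebra 𝕜 𝔤]

namespace LocalTrivialization

variable (T T' : LocalTrivialization 𝕜 I M A 𝔤) {q : ℕ}

/-- The isomorphism `w ↦ Ψ ∘ w ∘ S⁻¹` from the `𝔤`-valued alternating maps on a fibre of `TLA(U, 𝔤)`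
to the `L`-valued alternating maps on the corresponding fibre of `A`. It compares local forms for
different trivializations, and with global forms, on the same fibre of `A`. -/
def alternatingEquiv (q : ℕ) (x : T.U) :
    (TLAFibre 𝕜 I 𝔤 (x : M) [⋀^Fin q]→ₗ[𝕜] 𝔤) ≃ₗ[𝕜]
      (Fibre 𝕜 I A (x : M) [⋀^Fin q]→ₗ[𝕜] KernelFibre 𝕜 I A (x : M)) :=
  (AlternatingMap.domLCongr 𝕜 𝔤 (Fin q) 𝕜 (T.S x)).trans (T.Ψ x).alternatingMapCongrRight

variable [FiniteDimensional ℝ E] [IsManifold I ∞ M] [T2Space M]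

theorem isSection_alternatingEquiv (w : LocalForm 𝕜 I 𝔤 T.U q) (a : Fin q → A) :
    IsSection 𝕜 I fun x : T.U => (T.alternatingEquiv q x (w.1 x) fun k =>
      value 𝕜 I (a k) (x : M) : Fibre 𝕜 I A (x : M)) :=
  T.isSection_Ψ _ (w.2 (fun k x => (T.S x).symm (value 𝕜 I (a k) (x : M))) fun k =>
    T.isTLASection_S_symm le_rfl (isSection_value T.U (a k)))

variable [FiniteDimensional 𝕜 𝔤]

theorem loc_eq_iff {W : Form 𝕜 I M A q} {w : LocalForm 𝕜 I 𝔤 T.U q} :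
    T.loc W = w ↔ ∀ x : T.U, formAt W (x : M) = T.alternatingEquiv q x (w.1 x) :=
  (Subtype.ext_iff.trans funext_iff).trans <| forall_congr' fun x =>
    (T.alternatingEquiv q x).symm_apply_eq (x := formAt W (x : M))

theorem alphaHat_restrict_eq_iff {w : LocalForm 𝕜 I 𝔤 T.U q} {w' : LocalForm 𝕜 I 𝔤 T'.U q} :
    T.alphaHat T' (LocalForm.restrict inf_le_right w') = LocalForm.restrict inf_le_left w ↔
      ∀ (x : M) (hx : x ∈ T.U) (hx' : x ∈ T'.U),
        T'.alternatingEquiv q ⟨x, hx'⟩ (w'.1 ⟨x, hx'⟩) =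
          T.alternatingEquiv q ⟨x, hx⟩ (w.1 ⟨x, hx⟩) := by
  rw [Subtype.ext_iff, funext_iff]
  constructor
  · intro h x hx hx'
    exact (T.alternatingEquiv q ⟨x, hx⟩).symm_apply_eq.1 (h ⟨x, hx, hx'⟩)
  · intro h x
    exact (T.alternatingEquiv q ⟨x, x.2.1⟩).symm_apply_eq.2 (h x x.2.1 x.2.2)

end LocalTrivialization

namespace Atlas

variable [FiniteDimensional ℝ E] [IsManifold I ∞ M] [T2Space M]
  [Module.Finite (SmoothFun 𝕜 I M) A] [Module.Projective (SmoothFun 𝕜 I M) A]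
  {ι : Type*} (𝒜 : Atlas 𝕜 I M A 𝔤 ι) {q : ℕ}

theorem exists_formAt_eq_alternatingEquiv (w : ∀ i, LocalForm 𝕜 I 𝔤 (𝒜.triv i).U q)
    (h : ∀ i j x (hi : x ∈ (𝒜.triv i).U) (hj : x ∈ (𝒜.triv j).U),
      (𝒜.triv j).alternatingEquiv q ⟨x, hj⟩ ((w j).1 ⟨x, hj⟩) =
        (𝒜.triv i).alternatingEquiv q ⟨x, hi⟩ ((w i).1 ⟨x, hi⟩)) :
    ∃ W : Form 𝕜 I M A q, ∀ i (x : (𝒜.triv i).U),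
      formAt W (x : M) = (𝒜.triv i).alternatingEquiv q x ((w i).1 x) := by
  choose c hc using 𝒜.cover
  obtain ⟨W, hW⟩ := exists_formAt_eq
    (fun x => (𝒜.triv (c x)).alternatingEquiv q ⟨x, hc x⟩ ((w (c x)).1 ⟨x, hc x⟩)) fun a x _ => by
      obtain ⟨p, hp⟩ := (𝒜.triv (c x)).isSection_alternatingEquiv (w (c x)) a x (hc x)
      refine ⟨p, ?_⟩
      filter_upwards [hp, (𝒜.triv (c x)).U.isOpen.mem_nhds (hc x)] with y hy hyU _
      rw [h (c x) (c y) y hyU (hc y), hy hyU]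
  exact ⟨W, fun i x => (hW x).trans (h i (c x) x x.2 (hc x))⟩

theorem exists_loc_eq_iff [FiniteDimensional 𝕜 𝔤] (w : ∀ i, LocalForm 𝕜 I 𝔤 (𝒜.triv i).U q) :
    (∃ W : Form 𝕜 I M A q, ∀ i, (𝒜.triv i).loc W = w i) ↔
      ∀ i j, (((𝒜.triv i).U ⊓ (𝒜.triv j).U : Opens M) : Set M).Nonempty →
        (𝒜.triv i).alphaHat (𝒜.triv j) (LocalForm.restrict inf_le_right (w j))
          = LocalForm.restrict inf_le_left (w i) := by
  simp only [LocalTrivialization.loc_eq_iff, LocalTrivialization.alphaHat_restrict_eq_iff]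
  constructor
  · rintro ⟨W, hW⟩ i j - x hi hj
    exact (hW j ⟨x, hj⟩).symm.trans (hW i ⟨x, hi⟩)
  · intro h
    exact 𝒜.exists_formAt_eq_alternatingEquiv w fun i j x hi hj => h i j ⟨x, hi, hj⟩ x hi hj

end Atlas

end Gluing

end TransitiveLieAlgebroid

theorem mainTheorem1_general {𝕜 : Type*} [RCLike 𝕜]
    {E : Type*} [NormedAddCommGroup E] [NormedSpace ℝ E] [FiniteDimensional ℝ E]
    {H : Type*} [TopologicalSpace H] {I : ModelWithCorners ℝ E H}
    {M : Type*} [TopologicalSpace M] [ChartedSpace H M] [IsManifold I ∞ M] [T2Space M]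
    {A : Type*} [LieRing A] [LieAlgebra 𝕜 A] [Module (SmoothFun 𝕜 I M) A]
    [LieRingModule A (SmoothFun 𝕜 I M)] [LieRinehartRing (SmoothFun 𝕜 I M) A]
    [LieRinehartAlgebra 𝕜 (SmoothFun 𝕜 I M) A]
    [Module.Finite (SmoothFun 𝕜 I M) A] [Module.Projective (SmoothFun 𝕜 I M) A]
    {𝔤 : Type*} [LieRing 𝔤] [LieAlgebra 𝕜 𝔤] [FiniteDimensional 𝕜 𝔤]
    {ι : Type*} (𝒜 : Atlas 𝕜 I M A 𝔤 ι)
    (w : ∀ i, DirectSum ℕ fun q => LocalForm 𝕜 I 𝔤 (𝒜.triv i).U q) :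
    (∃ W : DirectSum ℕ fun q => Form 𝕜 I M A q,
      ∀ i q, (𝒜.triv i).loc (W q) = w i q) ↔
    ∀ i j, (((𝒜.triv i).U ⊓ (𝒜.triv j).U : Opens M) : Set M).Nonempty →
      ∀ q, (𝒜.triv i).alphaHat (𝒜.triv j) (LocalForm.restrict inf_le_right (w j q))
        = LocalForm.restrict inf_le_left (w i q) := by
  constructor
  · rintro ⟨W, hW⟩ i j hij q
    exact (𝒜.exists_loc_eq_iff fun i => w i q).1 ⟨W q, fun i => hW i q⟩ i j hij
  · intro h
    choose W hW using fun q =>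
      (𝒜.exists_loc_eq_iff fun i => w i q).2 fun i j hij => h i j hij q
    obtain ⟨n, hn⟩ := exists_forall_alternatingMap_eq_zero (SmoothFun 𝕜 I M) A (Kernel 𝕜 I M A)
    obtain ⟨V, hV⟩ := exists_directSum_apply_eq W (Finset.Iic n) fun q hq =>
      hn q (by simpa using hq) (W q)
    exact ⟨V, fun i q => by rw [hV, hW]⟩

theorem mainTheorem1 {𝕜 : Type*} [RCLike 𝕜]
    -- the base manifold
    {E : Type*} [NormedAddCommGroup E] [NormedSpace ℝ E] [FiniteDimensional ℝ E]
    {H : Type*} [TopologicalSpace H] (I : ModelWithCorners ℝ E H) [I.Boundaryless]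
    {M : Type*} [TopologicalSpace M] [ChartedSpace H M] [IsManifold I ∞ M]
    [T2Space M] [SigmaCompactSpace M]
    -- the transitive Lie algebroid
    {A : Type*} [LieRing A] [LieAlgebra 𝕜 A] [Module (SmoothFun 𝕜 I M) A]
    [LieRingModule A (SmoothFun 𝕜 I M)] [LieRinehartRing (SmoothFun 𝕜 I M) A]
    [LieRinehartAlgebra 𝕜 (SmoothFun 𝕜 I M) A]
    [Module.Finite (SmoothFun 𝕜 I M) A] [Module.Projective (SmoothFun 𝕜 I M) A]
    (hA : IsTransitive 𝕜 I M A)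
    -- the Lie algebra on which the kernel is modelled, and the atlas
    {𝔤 : Type*} [LieRing 𝔤] [LieAlgebra 𝕜 𝔤] [FiniteDimensional 𝕜 𝔤]
    {ι : Type*} (𝒜 : Atlas 𝕜 I M A 𝔤 ι)
    -- the family of local forms, in the total graded spaces
    (w : ∀ i, DirectSum ℕ fun q => LocalForm 𝕜 I 𝔤 (𝒜.triv i).U q) :
    (∃ W : DirectSum ℕ fun q => Form 𝕜 I M A q,
      ∀ i q, (𝒜.triv i).loc (W q) = w i q) ↔
    ∀ i j, (((𝒜.triv i).U ⊓ (𝒜.triv j).U : Opens M) : Set M).Nonempty →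
      ∀ q, (𝒜.triv i).alphaHat (𝒜.triv j) (LocalForm.restrict inf_le_right (w j q))
        = LocalForm.restrict inf_le_left (w i q) :=
  mainTheorem1_general 𝒜 w
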